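/- Let $r\ge 1$ and $s\ge 3$. Let $\mathsf{EqC}_r^s$ (resp. $\mathsf{C}_r^s$) be the set of tuples $(\lambda^1,\dots,\lambda^{s-1},\nu)\in(\mathbb{R}^r)^s$ for which there are $r\times r$ Hermitian matrices $A_1,\dots,A_{s-1},C$ whose eigenvalues, listed in weakly decreasing order with multiplicity, are $\lambda^1,\dots,\lambda^{s-1},\nu$, and such that $A_1+\dots+A_{s-1}-C$ is positive semidefinite (resp. zero). Put $$\mathsf{LR}_r^s=\{(\lambda^1,\dots,\lambda^{s-1},\nu)\in\mathsf{C}_r^s : \lambda^j_r\ge 0 \ \forall j\},\qquad \mathsf{EqLR}_r^s=\{(\lambda^1,\dots,\lambda^{s-1},\nu)\in\mathsf{EqC}_r^s : \lambda^j_r\ge 0 \text{ and } \lambda^j_i\le\nu_i\ \forall i,j\}.$$ For a $d$-element set $I=\{i_1<\dots<i_d\}\subseteq[r]$ let $\tau(I)=(i_d-d\ge\dots\ge i_1-1)$. For partitions with at most $d$ parts, let $c_{\mu^1,\dots,\mu^{s-1}}^{\kappa}$ be the coefficient of the Schur polynomial $s_\kappa(x_1,\dots,x_d)$ in the product $s_{\mu^1}\cdots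 s_{\mu^{s-1}}$ (equivalently, the structure coefficient of Schubert classes in $H^*(\mathrm{Gr}(d,\mathbb{C}^n))$, $n\gg0$). For every $1\le d<r$ and all $d$-element subsets $I_1,\dots,I_{s-1},K\subseteq[r]$ with $c_{\tau(I_1),\dots,\tau(I_{s-1})}^{\tau(K)}=1$, the associated Horn facet is $$\Big\{(\lambda^1,\dots,\lambda^{s-1},\nu)\in\mathsf{EqLR}_r^s : \sum_{j=1}^{s-1}\sum_{a\in I_j}\lambda^j_a=\sum_{k\in K}\nu_k\Big\};$$ if $r=1$, the only Horn facet is, by convention, $\{\sum_j\lambda^j_1=\nu_1\}\cap\mathsf{EqLR}_1^s$. Let $\omega_r=(1,\dots,1)\in\mathbb{R}^r$, and for $1\le j\le s-1$ let $x_j=(0,\dots,0,\omega_r,0,\dots,0,\omega_r)\in(\mathbb{R}^r)^s$, with $\omega_r$ in positions $j$ and $s$. Then: (1) If $(\lambda^1,\dots,\lambda^{s-1},\nu)\in\mathsf{EqLR}_r^s$ lies on every Horn facet, then it belongs to $\mathsf{LR}_r^s$, and each $\lambda^p$, as well as $\nu$, is a scalar multiple of $\omega_r$. (2) The extremal rays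 of $\mathsf{EqLR}_r^s$ that lie on every Horn facet are exactly the rays $\mathbb{R}_{\ge0}x_1,\dots,\mathbb{R}_{\ge0}x_{s-1}$. -/

import Mathlib

open scoped ComplexOrder

noncomputable section

namespace EqHorn

/-! ### Schur polynomials and Littlewood-Richardson coefficients -/

/-- Partitions `p 0 ≥ p 1 ≥ ... ≥ p (d - 1) ≥ 0` with at most `d` parts. -/
abbrev Part (d : ℕ) : Type := {p : Fin d → ℕ // Antitone p}

/-- The strictly decreasing exponent vector `p + (d - 1, ..., 1, 0)`. -/
def shifted {d : ℕ} (p : Part d) (j : Fin d) : ℕ := p.1 j + (Fin.rev j : ℕ)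

/-- The alternant `det (x_i ^ (p_j + d - j))` (with `1 ≤ i, j ≤ d`) in `ℤ[x_1, ..., x_d]`. -/
def alternant {d : ℕ} (p : Part d) : MvPolynomial (Fin d) ℤ :=
  Matrix.det (Matrix.of fun i j : Fin d => (MvPolynomial.X i : MvPolynomial (Fin d) ℤ) ^ shifted p j)

/-- The empty partition. -/
def emptyPart (d : ℕ) : Part d := ⟨fun _ => 0, antitone_const⟩

/-- The Schur polynomial `s_p(x_1, ..., x_d)`, given by the bialternant formula as an element of the
field of rational functions. -/
def schur {d : ℕ} (p : Part d) : FractionRing (MvPolynomial (Fin d) ℤ) :=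
  algebraMap _ _ (alternant p) / algebraMap _ _ (alternant (emptyPart d))

/-- `∑ ν, c ν • s_ν` for a finitely supported family `c` of integers. -/
def schurSum {d : ℕ} (c : Part d →₀ ℤ) : FractionRing (MvPolynomial (Fin d) ℤ) :=
  Finsupp.linearCombination ℤ (schur (d := d)) c

/-- The multiple-factor Littlewood-Richardson coefficient: the coefficient of `s_nu` in the
expansion of `∏ j, s_{lam j}` in Schur polynomials. (The expansion is unique by
`schurSum_injective`, and so `Function.invFun schurSum` reads it off.) -/
def lrCoeff {d m : ℕ} (lam : Fin m → Part d) (nu : Part d) : ℤ :=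
  Function.invFun schurSum (∏ j, schur (lam j)) nu

theorem shifted_strictAnti {d : ℕ} (p : Part d) : StrictAnti (shifted p) := by
  intro a b hab
  have h1 := p.2 hab.le
  have h2 : (Fin.rev b : ℕ) < (Fin.rev a : ℕ) := Fin.rev_lt_rev.2 hab
  unfold shifted
  omega

theorem shifted_injective {d : ℕ} {p q : Part d} (h : shifted p = shifted q) : p = q := by
  apply Subtype.ext
  funext j
  have := congrFun h j
  unfold shifted at this
  omega

theorem coeff_alternant {d : ℕ} (p q : Part d) :
    MvPolynomial.coeff (Finsupp.equivFunOnFinite.symm (shifted q)) (alternant p) =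
      if p = q then 1 else 0 := by
  classical
  have key : ∀ σ : Equiv.Perm (Fin d),
      MvPolynomial.coeff (Finsupp.equivFunOnFinite.symm (shifted q))
        (∏ i, (MvPolynomial.X (σ i) : MvPolynomial (Fin d) ℤ) ^ shifted p i) =
      if p = q ∧ σ = 1 then 1 else 0 := by
    intro σ
    have hmon : (∏ i, (MvPolynomial.X (σ i) : MvPolynomial (Fin d) ℤ) ^ shifted p i) =
        MvPolynomial.monomial (Finsupp.equivFunOnFinite.symm (fun i => shifted p (σ.symm i))) 1 := by
      rw [MvPolynomial.monomial_eq, map_one, one_mul, Finsupp.prod_fintype _ _ (by simp)]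
      refine Fintype.prod_equiv σ _ _ fun i => ?_
      simp
    rw [hmon, MvPolynomial.coeff_monomial]
    refine if_congr ⟨fun h => ?_, ?_⟩ rfl rfl
    · have h' : (fun i => shifted p (σ.symm i)) = shifted q :=
        Finsupp.equivFunOnFinite.symm.injective h
      have hr : Set.range (shifted p) = Set.range (shifted q) := by
        rw [← h']
        exact (σ.symm.surjective.range_comp (shifted p)).symm
      have hpq : shifted p = shifted q := by
        have hp : StrictMono fun i => OrderDual.toDual (shifted p i) :=
          fun a b hab => shifted_strictAnti p hab
        have hq : StrictMono fun i => OrderDual.toDual (shifted q i) :=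
          fun a b hab => shifted_strictAnti q hab
        exact (hp.range_inj hq).1 hr
      refine ⟨shifted_injective hpq, ?_⟩
      rw [← hpq] at h'
      ext i
      have h2 := congrFun h' (σ i)
      simp only [Equiv.symm_apply_apply] at h2
      have := (shifted_strictAnti p).injective h2
      simp [← this]
    · rintro ⟨rfl, rfl⟩
      rfl
  unfold alternant
  rw [Matrix.det_apply, MvPolynomial.coeff_sum]
  simp only [Matrix.of_apply, MvPolynomial.coeff_smul, key]
  by_cases hpq : p = q
  · simp [hpq]
  · simp [hpq]

theorem alternant_ne_zero {d : ℕ} (p : Part d) : alternant p ≠ 0 := by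
  intro h
  have := coeff_alternant p p
  rw [h] at this
  simp at this

/-- Schur polynomials are linearly independent. -/
theorem schurSum_injective {d : ℕ} : Function.Injective (schurSum (d := d)) := by
  classical
  have hinj : Function.Injective
      (algebraMap (MvPolynomial (Fin d) ℤ) (FractionRing (MvPolynomial (Fin d) ℤ))) :=
    IsFractionRing.injective _ _
  have hker : ∀ c : Part d →₀ ℤ, schurSum c = 0 → c = 0 := by
    intro c hc
    have h0 : algebraMap (MvPolynomial (Fin d) ℤ) (FractionRing (MvPolynomial (Fin d) ℤ))
        (alternant (emptyPart d)) ≠ 0 := by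
      rw [Ne, map_eq_zero_iff _ hinj]
      exact alternant_ne_zero _
    have h1 : c.sum (fun p n => n • alternant p) = 0 := by
      apply hinj
      rw [map_zero, Finsupp.sum, map_sum]
      rw [schurSum, Finsupp.linearCombination_apply, Finsupp.sum] at hc
      have h2 := congrArg (· * algebraMap (MvPolynomial (Fin d) ℤ)
        (FractionRing (MvPolynomial (Fin d) ℤ)) (alternant (emptyPart d))) hc
      simp only [Finset.sum_mul, zero_mul] at h2
      rw [← h2]
      refine Finset.sum_congr rfl fun p _ => ?_
      rw [map_zsmul, smul_mul_assoc, schur, div_mul_cancel₀ _ h0]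
    ext q
    have h3 := congrArg (MvPolynomial.coeff (Finsupp.equivFunOnFinite.symm (shifted q))) h1
    rw [Finsupp.sum, MvPolynomial.coeff_sum] at h3
    simp only [MvPolynomial.coeff_smul, coeff_alternant] at h3
    simpa using h3
  have hlin : Function.Injective (Finsupp.linearCombination ℤ (schur (d := d))) :=
    (injective_iff_map_eq_zero _).2 hker
  exact hlin

theorem lrCoeff_eq {d m : ℕ} (lam : Fin m → Part d) (c : Part d →₀ ℤ)
    (h : ∏ j, schur (lam j) = schurSum c) (nu : Part d) : lrCoeff lam nu = c nu := by
  rw [lrCoeff, h, Function.leftInverse_invFun schurSum_injective c]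

/-! ### Subsets and partitions -/

/-- `d`-element subsets of `[r]`, where `[r]` is modelled by `Fin r = {0, ..., r - 1}`. -/
abbrev Sub (r d : ℕ) : Type := {S : Finset (Fin r) // S.card = d}

/-- The entry `i_{d - j} - (d - j)` of `τ(I)`, where `I = {i_1 < ... < i_d}` (`j` counted from `0`;
the difference does not depend on whether indices start from `0` or `1`). -/
def tauFun {r d : ℕ} (I : Sub r d) (j : Fin d) : ℕ :=
  (I.1.orderEmbOfFin I.2 (Fin.rev j) : ℕ) - (Fin.rev j : ℕ)

theorem tauFun_antitone {r d : ℕ} (I : Sub r d) : Antitone (tauFun I) := by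
  have step : ∀ (n : ℕ) (a b : Fin d), (b : ℕ) = a + n →
      (I.1.orderEmbOfFin I.2 a : ℕ) + n ≤ I.1.orderEmbOfFin I.2 b := by
    intro n
    induction n with
    | zero =>
      intro a b h
      have : b = a := Fin.ext (by simpa using h)
      simp [this]
    | succ n ih =>
      intro a b h
      have hb := b.2
      let b' : Fin d := ⟨a + n, by omega⟩
      have h1 := ih a b' rfl
      have h2 : b' < b := by
        rw [Fin.lt_def]
        show (a : ℕ) + n < b
        omega
      have h3 : I.1.orderEmbOfFin I.2 b' < I.1.orderEmbOfFin I.2 b :=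
        (I.1.orderEmbOfFin I.2).strictMono h2
      rw [Fin.lt_def] at h3
      omega
  intro j k hjk
  have h1 : Fin.rev k ≤ Fin.rev j := Fin.rev_le_rev.2 hjk
  rw [Fin.le_def] at h1
  have h2 := step ((Fin.rev j : ℕ) - (Fin.rev k : ℕ)) (Fin.rev k) (Fin.rev j) (by omega)
  unfold tauFun
  omega

/-- The partition `τ(I) = (i_d - d ≥ ... ≥ i_2 - 2 ≥ i_1 - 1)`. -/
def tau {r d : ℕ} (I : Sub r d) : Part d := ⟨tauFun I, tauFun_antitone I⟩

/-! ### The cones -/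

/-- The ambient space `(ℝ^r)^s` of tuples `x = (λ¹, ..., λ^{s-1}, ν)`: `x.1 j` is `λ^j` and `x.2`
is `ν`. -/
abbrev Tuple (r s : ℕ) : Type := (Fin (s - 1) → Fin r → ℝ) × (Fin r → ℝ)

/-- `A` is Hermitian and its eigenvalues, listed in weakly decreasing order with multiplicity,
are `lam 0 ≥ lam 1 ≥ ... `. -/
def HasSpectrum {r : ℕ} (A : Matrix (Fin r) (Fin r) ℂ) (lam : Fin r → ℝ) : Prop :=
  A.IsHermitian ∧ Antitone lam ∧
    A.charpoly = ∏ i, (Polynomial.X - Polynomial.C ((lam i : ℝ) : ℂ))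

/-- Eigenvalues of Hermitian matrices with `A_1 + ... + A_{s-1} = C`. -/
def coneC (r s : ℕ) : Set (Tuple r s) :=
  {x | ∃ (A : Fin (s - 1) → Matrix (Fin r) (Fin r) ℂ) (C : Matrix (Fin r) (Fin r) ℂ),
    (∀ j, HasSpectrum (A j) (x.1 j)) ∧ HasSpectrum C x.2 ∧ ∑ j, A j = C}

/-- Eigenvalues of Hermitian matrices with `A_1 + ... + A_{s-1} ≥ C`. -/
def coneEqC (r s : ℕ) : Set (Tuple r s) :=
  {x | ∃ (A : Fin (s - 1) → Matrix (Fin r) (Fin r) ℂ) (C : Matrix (Fin r) (Fin r) ℂ),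
    (∀ j, HasSpectrum (A j) (x.1 j)) ∧ HasSpectrum C x.2 ∧ (∑ j, A j - C).PosSemidef}

/-- The Littlewood-Richardson cone. (Each `λ^j` is weakly decreasing, so nonnegativity of all its
entries is nonnegativity of the last one.) -/
def coneLR (r s : ℕ) : Set (Tuple r s) :=
  {x | x ∈ coneC r s ∧ ∀ j i, 0 ≤ x.1 j i}

/-- The equivariant Littlewood-Richardson cone. -/
def coneEqLR (r s : ℕ) : Set (Tuple r s) :=
  {x | x ∈ coneEqC r s ∧ (∀ j i, 0 ≤ x.1 j i) ∧ ∀ j i, x.1 j i ≤ x.2 i}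

/-! ### Horn facets and extremal rays -/

/-- The index tuples of Horn inequalities: `d`-element subsets `I_1, ..., I_{s-1}, K` of `[r]` with
`1 ≤ d < r` and Littlewood-Richardson coefficient `1`. For `r = 1`, where no such `d` exists, the
inequality `∑ |λ^j| ≥ |ν|` (the case `d = r`) counts as a Horn inequality. -/
def IsHornDatum {r s d : ℕ} (I : Fin (s - 1) → Sub r d) (K : Sub r d) : Prop :=
  1 ≤ d ∧ (d < r ∨ r = 1) ∧ lrCoeff (fun j => tau (I j)) (tau K) = 1

/-- The Horn facet of the equivariant cone associated with `I_1, ..., I_{s-1}, K`. -/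
def hornFacet {r s d : ℕ} (I : Fin (s - 1) → Sub r d) (K : Sub r d) : Set (Tuple r s) :=
  {x | ∑ j, ∑ a ∈ (I j).1, x.1 j a = ∑ k ∈ K.1, x.2 k} ∩ coneEqLR r s

/-- `R` lies on every Horn facet. -/
def OnEveryHornFacet {r s : ℕ} (R : Set (Tuple r s)) : Prop :=
  ∀ (d : ℕ) (I : Fin (s - 1) → Sub r d) (K : Sub r d), IsHornDatum I K → R ⊆ hornFacet I K

/-- The ray `ℝ_{≥0} x`. -/
def ray {V : Type*} [AddCommGroup V] [Module ℝ V] (x : V) : Set V :=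
  {y | ∃ t : ℝ, 0 ≤ t ∧ y = t • x}

/-- Extremal rays of a cone: rays that are faces of dimension one. -/
def IsExtremalRay {V : Type*} [AddCommGroup V] [Module ℝ V] (S R : Set V) : Prop :=
  (∃ x : V, x ≠ 0 ∧ R = ray x) ∧ IsExtreme ℝ S R

/-- `ω_k = (1, ..., 1, 0, ..., 0)`, with `k` ones. -/
def omega (r k : ℕ) : Fin r → ℝ := fun i => if (i : ℕ) < k then 1 else 0

/-- `x_j = (0, ..., ω_r, ..., 0, ω_r)`, with `ω_r` in position `j` and in the last position. -/
def xvec (r s : ℕ) (j : Fin (s - 1)) : Tuple r s := (Pi.single j (omega r r), omega r r)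

end EqHorn

end

namespace EqHorn

/-! The facets with `d = 1` already suffice. In one variable Schur polynomials are monomials, so
such facets give `∑ j, λ^j_{a_j} = ν_k` whenever `∑ j, a_j = k` (indices from `0`). Moving a single
`a_p` from `0` to `k` shows that `λ^p_k - λ^p_0 = ν_k - ν_0 ≤ 0` for every `p`. The trace inequality
then reads `(s - 2) ∑ k, (ν_k - ν_0) ≥ 0`, and `s ≥ 3` forces all these differences to vanish
(`exists_eq_scalarTuple`). Points on every Horn facet are thus nonnegative combinations of the
`x_j`; it remains to see that each `x_j` spans an extremal ray (`isExtreme_ray_xvec`) and that no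
other combination does (`exists_ray_eq_of_isExtreme`). -/

theorem HasSpectrum.trace_eq {r : ℕ} {A : Matrix (Fin r) (Fin r) ℂ} {lam : Fin r → ℝ}
    (h : HasSpectrum A lam) : A.trace = ((∑ i, lam i : ℝ) : ℂ) := by
  rw [Matrix.trace_eq_sum_roots_charpoly, h.2.2, Polynomial.roots_prod]
  · simp [List.sum_ofFn]
  · exact Finset.prod_ne_zero_iff.2 fun i _ => Polynomial.X_sub_C_ne_zero _

theorem hasSpectrum_scalar (r : ℕ) (c : ℝ) :
    HasSpectrum (Matrix.diagonal fun _ : Fin r => (c : ℂ)) (c • omega r r) := by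
  refine ⟨?_, ?_, ?_⟩
  · exact Matrix.isHermitian_diagonal_of_self_adjoint _ (by ext i; simp)
  · intro i j _
    simp [omega]
  · rw [Matrix.charpoly_diagonal]
    simp [omega]

/-- Eigenvalues of a positive semidefinite difference have nonnegative total. -/
theorem sum_le_of_mem_coneEqC {r s : ℕ} {x : Tuple r s} (hx : x ∈ coneEqC r s) :
    ∑ i, x.2 i ≤ ∑ j, ∑ i, x.1 j i := by
  obtain ⟨A, C, hA, hC, hpos⟩ := hx
  have h := hpos.trace_nonneg
  rw [Matrix.trace_sub, Matrix.trace_sum, hC.trace_eq,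
    Finset.sum_congr rfl fun j _ => (hA j).trace_eq, sub_nonneg] at h
  exact_mod_cast h

theorem antitone_fst_of_mem_coneEqC {r s : ℕ} {x : Tuple r s} (hx : x ∈ coneEqC r s)
    (j : Fin (s - 1)) : Antitone (x.1 j) := by
  obtain ⟨A, C, hA, -, -⟩ := hx
  exact (hA j).2.1

theorem antitone_snd_of_mem_coneEqC {r s : ℕ} {x : Tuple r s} (hx : x ∈ coneEqC r s) :
    Antitone x.2 := by
  obtain ⟨A, C, -, hC, -⟩ := hx
  exact hC.2.1

theorem coneC_subset_coneEqC (r s : ℕ) : coneC r s ⊆ coneEqC r s := by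
  rintro x ⟨A, C, hA, hC, h⟩
  refine ⟨A, C, hA, hC, ?_⟩
  rw [h, sub_self]
  exact Matrix.PosSemidef.zero

@[simp]
theorem omega_self_apply (r : ℕ) (i : Fin r) : omega r r i = 1 := by
  simp [omega]

/-! ### Tuples of scalar spectra -/

/-- The tuple of eigenvalues of the scalar matrices `c j` and of their sum. -/
def scalarTuple (r s : ℕ) (c : Fin (s - 1) → ℝ) : Tuple r s :=
  (fun j => c j • omega r r, (∑ j, c j) • omega r r)

theorem scalarTuple_mem_coneLR {r s : ℕ} {c : Fin (s - 1) → ℝ} (hc : 0 ≤ c) :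
    scalarTuple r s c ∈ coneLR r s := by
  refine ⟨⟨fun j => Matrix.diagonal fun _ => (c j : ℂ),
    Matrix.diagonal fun _ => ((∑ j, c j : ℝ) : ℂ),
    fun j => hasSpectrum_scalar r _, hasSpectrum_scalar r _, ?_⟩, fun j i => ?_⟩
  · ext a b
    rw [Matrix.sum_apply]
    by_cases h : a = b <;> simp [h]
  · simpa [scalarTuple] using hc j

theorem scalarTuple_mem_coneEqLR {r s : ℕ} {c : Fin (s - 1) → ℝ} (hc : 0 ≤ c) :
    scalarTuple r s c ∈ coneEqLR r s := by
  have h := scalarTuple_mem_coneLR (r := r) hc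
  refine ⟨coneC_subset_coneEqC r s h.1, h.2, fun j i => ?_⟩
  simpa [scalarTuple] using Finset.single_le_sum (fun k _ => hc k) (Finset.mem_univ j)

theorem scalarTuple_add (r s : ℕ) (c c' : Fin (s - 1) → ℝ) :
    scalarTuple r s (c + c') = scalarTuple r s c + scalarTuple r s c' := by
  ext <;> simp [scalarTuple, Finset.sum_add_distrib]

theorem scalarTuple_smul (r s : ℕ) (t : ℝ) (c : Fin (s - 1) → ℝ) :
    scalarTuple r s (t • c) = t • scalarTuple r s c := by
  ext <;> simp [scalarTuple, Finset.mul_sum]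

theorem scalarTuple_single (r s : ℕ) (j : Fin (s - 1)) :
    scalarTuple r s (Pi.single j 1) = xvec r s j := by
  ext k i
  · by_cases h : k = j
    · subst h
      simp [scalarTuple, xvec]
    · simp [scalarTuple, xvec, h]
  · simp [scalarTuple, xvec]

/-- Since all the index sets have `d` elements, both sides of the Horn equation equal `d * ∑ j, c
j`, whatever the Littlewood-Richardson coefficient. -/
theorem scalarTuple_mem_hornFacet {r s d : ℕ} {c : Fin (s - 1) → ℝ} (hc : 0 ≤ c)
    (I : Fin (s - 1) → Sub r d) (K : Sub r d) : scalarTuple r s c ∈ hornFacet I K := by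
  refine ⟨?_, scalarTuple_mem_coneEqLR hc⟩
  simp [scalarTuple, K.2, fun j => (I j).2, Finset.mul_sum]

/-! ### Horn equations with `d = 1` -/

/-- The one-element subset `{a}` of `[r]`. -/
def singletonSub {r : ℕ} (a : Fin r) : Sub r 1 := ⟨{a}, Finset.card_singleton a⟩

theorem tau_singletonSub {r : ℕ} (a : Fin r) (i : Fin 1) : (tau (singletonSub a)).1 i = a := by
  have h := Finset.orderEmbOfFin_mem _ (singletonSub a).2 (Fin.rev i)
  rw [singletonSub, Finset.mem_singleton] at h
  simp [tau, tauFun, singletonSub, h]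

/-- In one variable, `s_p = x ^ p`. -/
theorem schur_one (p : Part 1) :
    schur p = algebraMap (MvPolynomial (Fin 1) ℤ) (FractionRing (MvPolynomial (Fin 1) ℤ)) (MvPolynomial.X 0) ^ p.1 0 := by
  simp [schur, alternant, shifted, emptyPart]

theorem isHornDatum_singletonSub {r s : ℕ} (a : Fin (s - 1) → Fin r) (k : Fin r)
    (h : ∑ j, (a j : ℕ) = k) :
    IsHornDatum (fun j => singletonSub (a j)) (singletonSub k) := by
  -- For `r = 1` this datum is the conventional one, so that case needs no separate treatment.
  refine ⟨le_rfl, by have := k.2; omega, ?_⟩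
  rw [lrCoeff_eq _ (Finsupp.single (tau (singletonSub k)) 1), Finsupp.single_eq_same]
  simp [schurSum, schur_one, tau_singletonSub, Finset.prod_pow_eq_pow_sum, h]

/-- A point on every Horn facet consists of the eigenvalues of scalar matrices. -/
theorem exists_eq_scalarTuple {r s : ℕ} (hr : 1 ≤ r) (hs : 3 ≤ s) {x : Tuple r s}
    (hx : x ∈ coneEqLR r s) (hH : OnEveryHornFacet {x}) :
    ∃ c : Fin (s - 1) → ℝ, 0 ≤ c ∧ x = scalarTuple r s c := by
  have horn : ∀ (a : Fin (s - 1) → Fin r) (k : Fin r), ∑ j, (a j : ℕ) = k →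
      ∑ j, x.1 j (a j) = x.2 k := by
    intro a k h
    simpa [singletonSub] using (hH 1 _ _ (isHornDatum_singletonSub a k h) rfl).1
  have : NeZero r := ⟨by omega⟩
  have h0 : ∑ j, x.1 j 0 = x.2 0 := horn (fun _ => 0) 0 (by simp)
  have hdiff : ∀ p k, x.1 p k - x.1 p 0 = x.2 k - x.2 0 := by
    intro p k
    -- Compared with `h0`, only the `p`-th index moves, so subtracting isolates one spectrum.
    have h := horn (Function.update (fun _ => 0) p k) k (by
      rw [Finset.sum_eq_single p] <;> simp +contextual [Function.update_of_ne])
    rw [← h, ← h0, ← Finset.sum_sub_distrib, Finset.sum_eq_single p]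
    · simp
    · intro b _ hb
      simp [Function.update_of_ne hb]
    · simp
  have hle : ∀ k, x.2 k - x.2 0 ≤ 0 := fun k =>
    sub_nonpos.2 (antitone_snd_of_mem_coneEqC hx.1 (Fin.zero_le k))
  have hsum : 0 ≤ ∑ k, (x.2 k - x.2 0) := by
    have htr := sum_le_of_mem_coneEqC hx.1
    have hcast : ((s - 1 : ℕ) : ℝ) = s - 1 := by
      rw [Nat.cast_sub (by omega), Nat.cast_one]
    have hcol : ∀ k, ∑ j, x.1 j k = x.2 0 + (s - 1) * (x.2 k - x.2 0) := by
      intro k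
      rw [Finset.sum_congr rfl fun j _ => (sub_eq_iff_eq_add'.1 (hdiff j k)),
        Finset.sum_add_distrib, h0]
      simp [hcast, mul_sub]
    rw [Finset.sum_comm, Finset.sum_congr rfl fun k _ => hcol k, ← sub_nonneg,
      ← Finset.sum_sub_distrib] at htr
    have h3 : (3 : ℝ) ≤ s := by exact_mod_cast hs
    have heq : ∑ k, (x.2 0 + (s - 1) * (x.2 k - x.2 0) - x.2 k) =
        (s - 2) * ∑ k, (x.2 k - x.2 0) := by
      rw [Finset.mul_sum]
      exact Finset.sum_congr rfl fun k _ => by ring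
    rw [heq] at htr
    exact nonneg_of_mul_nonneg_right htr (by linarith)
  have hzero : ∀ k, x.2 k - x.2 0 = 0 := fun k =>
    (Finset.sum_eq_zero_iff_of_nonpos fun i _ => hle i).1
      (le_antisymm (Finset.sum_nonpos fun i _ => hle i) hsum) k (Finset.mem_univ k)
  refine ⟨fun j => x.1 j 0, fun j => hx.2.1 j 0, ?_⟩
  ext j k
  · simpa [scalarTuple] using sub_eq_zero.1 ((hdiff j k).trans (hzero k))
  · simpa [scalarTuple, h0] using sub_eq_zero.1 (hzero _)

/-! ### Extremal rays -/

theorem ray_smul {V : Type*} [AddCommGroup V] [Module ℝ V] {t : ℝ} (ht : 0 < t) (x : V) :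
    ray (t • x) = ray x := by
  ext y
  constructor
  · rintro ⟨u, hu, rfl⟩
    exact ⟨u * t, by positivity, smul_smul u t x⟩
  · rintro ⟨u, hu, rfl⟩
    exact ⟨u / t, by positivity, by rw [smul_smul, div_mul_cancel₀ _ ht.ne']⟩

theorem self_mem_ray {V : Type*} [AddCommGroup V] [Module ℝ V] (x : V) : x ∈ ray x :=
  ⟨1, zero_le_one, (one_smul ℝ x).symm⟩

theorem smul_xvec_eq_scalarTuple (r s : ℕ) (t : ℝ) (j : Fin (s - 1)) :
    t • xvec r s j = scalarTuple r s (Pi.single j t) := by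
  rw [← scalarTuple_single, ← scalarTuple_smul, ← Pi.single_smul, smul_eq_mul, mul_one]

theorem isExtreme_ray_xvec {r : ℕ} (hr : 1 ≤ r) (s : ℕ) (j : Fin (s - 1)) :
    IsExtreme ℝ (coneEqLR r s) (ray (xvec r s j)) := by
  have : NeZero r := ⟨by omega⟩
  refine ⟨?_, ?_⟩
  · rintro _ ⟨t, ht, rfl⟩
    rw [smul_xvec_eq_scalarTuple]
    exact scalarTuple_mem_coneEqLR (Pi.single_nonneg.2 ht)
  · rintro u hu v hv _ ⟨t, ht, rfl⟩ ⟨a, b, ha, hb, -, h⟩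
    have hcoord : ∀ p i, a * u.1 p i + b * v.1 p i = t * (xvec r s j).1 p i := fun p i =>
      congrFun (congrFun (congrArg Prod.fst h) p) i
    have hu0 : ∀ p ≠ j, ∀ i, u.1 p i = 0 := by
      intro p hp i
      have h1 := hcoord p i
      simp only [xvec, Pi.single_eq_of_ne hp, Pi.zero_apply, mul_zero] at h1
      have h2 := hu.2.1 p i
      nlinarith [mul_nonneg ha.le h2, mul_nonneg hb.le (hv.2.1 p i)]
    -- Two weakly decreasing sequences with a constant positive combination are both constant.
    have hconst : ∀ i, u.1 j i = u.1 j 0 := by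
      intro i
      have h1 := (hcoord j i).trans (by simp [xvec] : _ = t * (xvec r s j).1 j 0)
      rw [← hcoord j 0] at h1
      have h2 := antitone_fst_of_mem_coneEqC hu.1 j (Fin.zero_le i)
      have h3 := antitone_fst_of_mem_coneEqC hv.1 j (Fin.zero_le i)
      nlinarith [mul_le_mul_of_nonneg_left h3 hb.le]
    -- Only `λ^j` is left in the trace inequality, so it bounds `∑ ν` by `∑ λ^j`; with `λ^j ≤ ν`
    -- entrywise, equality holds.
    have hnu : ∀ i, u.1 j i = u.2 i := by
      have htr := sum_le_of_mem_coneEqC hu.1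
      rw [Finset.sum_eq_single j (fun p _ hp => Finset.sum_eq_zero fun i _ => hu0 p hp i)
        (by simp)] at htr
      intro i
      exact (Finset.sum_eq_sum_iff_of_le fun k _ => hu.2.2 j k).1
        (le_antisymm (Finset.sum_le_sum fun k _ => hu.2.2 j k) htr) i (Finset.mem_univ i)
    refine ⟨u.1 j 0, hu.2.1 j 0, ?_⟩
    ext p i
    · by_cases hp : p = j
      · subst hp
        simpa [xvec] using hconst i
      · simpa [xvec, hp] using hu0 p hp i
    · simpa [xvec] using (hnu _).symm.trans (hconst _)

theorem xvec_ne_zero {r : ℕ} (hr : 1 ≤ r) (s : ℕ) (j : Fin (s - 1)) : xvec r s j ≠ 0 := by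
  intro h
  have h1 := congrFun (congrArg Prod.snd h) ⟨0, hr⟩
  simp [xvec] at h1

/-- An extremal ray through the eigenvalues of scalar matrices is spanned by some `x_j`. -/
theorem exists_ray_eq_of_isExtreme {r s : ℕ} {c : Fin (s - 1) → ℝ} (hc : 0 ≤ c)
    (h0 : scalarTuple r s c ≠ 0)
    (hext : IsExtreme ℝ (coneEqLR r s) (ray (scalarTuple r s c))) :
    ∃ j, ray (xvec r s j) = ray (scalarTuple r s c) := by
  obtain ⟨j, hj⟩ : ∃ j, c j ≠ 0 := by
    by_contra! hall
    refine h0 ?_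
    ext <;> simp [scalarTuple, hall]
  have hj' : 0 < c j := lt_of_le_of_ne (hc j) hj.symm
  have hr : xvec r s j ≠ 0 := by
    intro hx
    refine h0 ?_
    have hom : omega r r = 0 := congrArg Prod.snd hx
    ext <;> simp [scalarTuple, hom]
  -- The point is the midpoint of twice its `j`-th component and twice the rest, both in the cone;
  -- extremality puts the former on the ray.
  have hmem : scalarTuple r s (Pi.single j (2 * c j)) ∈ ray (scalarTuple r s c) := by
    refine hext.left_mem_of_mem_openSegment
      (scalarTuple_mem_coneEqLR (Pi.single_nonneg.2 (by positivity)))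
      (scalarTuple_mem_coneEqLR (c := (2 : ℝ) • Function.update c j 0) ?_) (self_mem_ray _)
      ⟨1 / 2, 1 / 2, by norm_num, by norm_num, by norm_num, ?_⟩
    · intro k
      by_cases hk : k = j
      · subst hk
        simp
      · simpa [hk] using hc k
    · rw [← scalarTuple_smul, ← scalarTuple_smul, ← scalarTuple_add]
      congr 1
      ext k
      by_cases hk : k = j
      · subst hk
        simp
      · simp [hk]
  obtain ⟨t, ht, heq⟩ := hmem
  rw [← smul_xvec_eq_scalarTuple] at heq
  have ht' : 0 < t := by
    refine lt_of_le_of_ne ht fun h => ?_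
    rw [← h, zero_smul] at heq
    exact (smul_ne_zero (by positivity) hr) heq
  exact ⟨j, by rw [← ray_smul ht' (scalarTuple r s c), ← heq, ray_smul (by positivity)]⟩

end EqHorn

theorem mainTheorem7 (r s : ℕ) (hr : 1 ≤ r) (hs : 3 ≤ s) :
    (∀ x : EqHorn.Tuple r s, x ∈ EqHorn.coneEqLR r s → EqHorn.OnEveryHornFacet {x} →
      x ∈ EqHorn.coneLR r s ∧
      (∀ p : Fin (s - 1), ∃ c : ℝ, x.1 p = c • EqHorn.omega r r) ∧
      ∃ c : ℝ, x.2 = c • EqHorn.omega r r) ∧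
    {R : Set (EqHorn.Tuple r s) |
        EqHorn.IsExtremalRay (EqHorn.coneEqLR r s) R ∧ EqHorn.OnEveryHornFacet R} =
      Set.range fun j : Fin (s - 1) => EqHorn.ray (EqHorn.xvec r s j) := by
  refine ⟨fun x hx hH => ?_, ?_⟩
  · obtain ⟨c, hc, rfl⟩ := EqHorn.exists_eq_scalarTuple hr hs hx hH
    exact ⟨EqHorn.scalarTuple_mem_coneLR hc, fun p => ⟨c p, rfl⟩, _, rfl⟩
  · ext R
    constructor
    · rintro ⟨⟨⟨x, hx0, rfl⟩, hext⟩, hH⟩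
      have hmem := EqHorn.self_mem_ray x
      obtain ⟨c, hc, rfl⟩ := EqHorn.exists_eq_scalarTuple hr hs (hext.subset hmem)
        fun d I K hIK => Set.singleton_subset_iff.2 (hH d I K hIK hmem)
      exact EqHorn.exists_ray_eq_of_isExtreme hc hx0 hext
    · rintro ⟨j, rfl⟩
      refine ⟨⟨⟨_, EqHorn.xvec_ne_zero hr s j, rfl⟩, EqHorn.isExtreme_ray_xvec hr s j⟩, ?_⟩
      rintro d I K - _ ⟨t, ht, rfl⟩
      rw [EqHorn.smul_xvec_eq_scalarTuple]
      exact EqHorn.scalarTuple_mem_hornFacet (Pi.single_nonneg.2 ht) I K
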